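/- Let $n$ be a nonnegative integer and let $f:\mathbb{Z}^n\to\mathbb{R}\cup\{+\infty\}$, with effective domain $\operatorname{dom} f=\{x\in\mathbb{Z}^n: f(x)<+\infty\}$. For real vectors, $\lceil\cdot\rceil$ and $\lfloor\cdot\rfloor$ denote componentwise rounding up and down; $\vee$ and $\wedge$ denote the componentwise maximum and minimum, and $\mathbf{1}=(1,\dots,1)$. The discrete midpoint inequality for a pair $x,y\in\mathbb{Z}^n$ is $$f(x)+f(y)\ \ge\ f\left(\left\lceil\tfrac{x+y}{2}\right\rceil\right)+f\left(\left\lfloor\tfrac{x+y}{2}\right\rfloor\right).\qquad(*)$$ The function $f$ is called - *$\mathrm{L}^\natural$-convex* if $f(x)+f(y)\ge f((x-\mu\mathbf{1})\vee y)+f(x\wedge(y+\mu\mathbf{1}))$ for all $x,y\in\mathbb{Z}^n$ and all integers $\mu\ge 0$; - *globally discrete midpoint convex* if $(*)$ holds for all $x,y\in\mathbb{Z}^n$ with $\|x-y\|_\infty\ge 2$; - *locally discrete midpoint convex* if $(*)$ holds for all $x,y\in\mathbb{Z}^n$ with $\|x-y\|_\infty=2$ and, in addition, $S=\operatorname{dom}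 f$ is a discrete midpoint convex set, that is, $\lceil\frac{x+y}{2}\rceil,\lfloor\frac{x+y}{2}\rfloor\in S$ for all $x,y\in S$ with $\|x-y\|_\infty\ge 2$; - *integrally convex* if its local convex envelope $\tilde f:\mathbb{R}^n\to\mathbb{R}\cup\{+\infty\}$, $$\tilde f(x)=\min\Big\{\sum_{z\in N(x)}\lambda_z f(z)\ :\ \lambda_z\ge 0,\ \sum_{z\in N(x)}\lambda_z=1,\ \sum_{z\in N(x)}\lambda_z z=x\Big\},\qquad N(x)=\{z\in\mathbb{Z}^n: |x_i-z_i|<1\ (i=1,\dots,n)\},$$ is convex on $\mathbb{R}^n$ (with the convention $0\cdot(+\infty)=0$). **Theorem.** (1) If $f$ is $\mathrm{L}^\natural$-convex, then $f$ is globally discrete midpoint convex. (2) If $f$ is globally discrete midpoint convex, then $f$ is locally discrete midpoint convex. (3) If $f$ is locally discrete midpoint convex, then $f$ is integrally convex. -/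

import Mathlib

noncomputable section

namespace DiscreteConvexity

variable {n : ℕ}

/-- The effective domain `{x | f x < +∞}` of `f : ℤⁿ → ℝ ∪ {+∞}`. -/
def effDom (f : (Fin n → ℤ) → WithTop ℝ) : Set (Fin n → ℤ) :=
  {x | f x < ⊤}

/-- The componentwise round-up `⌈(x + y) / 2⌉` of the midpoint. -/
def ceilMid (x y : Fin n → ℤ) : Fin n → ℤ :=
  fun i => ⌈((x i : ℝ) + (y i : ℝ)) / 2⌉

/-- The componentwise round-down `⌊(x + y) / 2⌋` of the midpoint. -/
def floorMid (x y : Fin n → ℤ) : Fin n → ℤ :=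
  fun i => ⌊((x i : ℝ) + (y i : ℝ)) / 2⌋

/-- The discrete midpoint convexity inequality for `f` at the pair `(x, y)`. -/
def DiscreteMidpointIneq (f : (Fin n → ℤ) → WithTop ℝ) (x y : Fin n → ℤ) : Prop :=
  f (ceilMid x y) + f (floorMid x y) ≤ f x + f y

/-- Discrete midpoint convex sets. The norm on `Fin n → ℤ` is the `ℓ_∞`-norm. -/
def IsDiscreteMidpointConvexSet (S : Set (Fin n → ℤ)) : Prop :=
  ∀ x ∈ S, ∀ y ∈ S, 2 ≤ ‖x - y‖ → ceilMid x y ∈ S ∧ floorMid x y ∈ S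

/-- `L♮`-convex functions, defined by translation-submodularity. -/
def IsLNaturalConvex (f : (Fin n → ℤ) → WithTop ℝ) : Prop :=
  ∀ (x y : Fin n → ℤ) (μ : ℕ),
    f ((x - fun _ => (μ : ℤ)) ⊔ y) + f (x ⊓ (y + fun _ => (μ : ℤ))) ≤ f x + f y

/-- Globally discrete midpoint convex functions. -/
def IsGloballyDiscreteMidpointConvex (f : (Fin n → ℤ) → WithTop ℝ) : Prop :=
  ∀ x y : Fin n → ℤ, 2 ≤ ‖x - y‖ → DiscreteMidpointIneq f x y

/-- Locally discrete midpoint convex functions. -/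
def IsLocallyDiscreteMidpointConvex (f : (Fin n → ℤ) → WithTop ℝ) : Prop :=
  IsDiscreteMidpointConvexSet (effDom f) ∧
    ∀ x y : Fin n → ℤ, ‖x - y‖ = 2 → DiscreteMidpointIneq f x y

/-- The integer neighborhood `N(x)` of a real point `x`. -/
def intNbhd (x : Fin n → ℝ) : Set (Fin n → ℤ) :=
  {z | ∀ i, |x i - (z i : ℝ)| < 1}

theorem intNbhd_finite (x : Fin n → ℝ) : (intNbhd x).Finite := by
  refine (Set.finite_Icc (fun i => ⌊x i⌋) (fun i => ⌈x i⌉)).subset ?_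
  intro z hz
  refine ⟨fun i => ?_, fun i => ?_⟩
  · have h := abs_lt.1 (hz i)
    have h1 : (⌊x i⌋ : ℝ) < ((z i + 1 : ℤ) : ℝ) := by
      push_cast
      linarith [Int.floor_le (x i), h.2]
    have h2 : ⌊x i⌋ < z i + 1 := by exact_mod_cast h1
    show ⌊x i⌋ ≤ z i
    omega
  · have h := abs_lt.1 (hz i)
    have h1 : (z i : ℝ) < ((⌈x i⌉ + 1 : ℤ) : ℝ) := by
      push_cast
      linarith [Int.le_ceil (x i), h.1]
    have h2 : z i < ⌈x i⌉ + 1 := by exact_mod_cast h1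
    show z i ≤ ⌈x i⌉
    omega

instance instFintypeIntNbhd (x : Fin n → ℝ) : Fintype (intNbhd x) :=
  (intNbhd_finite x).fintype

/-- The values `∑_{z ∈ N(x)} λ_z f(z)`, where `λ` runs over the coefficients of convex combinations
indexed by `N(x)` with `∑_{z ∈ N(x)} λ_z z = x`. In `WithTop ℝ` one has `0 * ⊤ = 0`, and
`c * ⊤ = ⊤` for `c > 0`. -/
def envelopeValues (f : (Fin n → ℤ) → WithTop ℝ) (x : Fin n → ℝ) : Set (WithTop ℝ) :=
  {v | ∃ c ∈ stdSimplex ℝ (intNbhd x),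
      (∀ i, ∑ z : intNbhd x, c z * ((z : Fin n → ℤ) i : ℝ) = x i) ∧
      v = ∑ z : intNbhd x, ((c z : ℝ) : WithTop ℝ) * f z}

/-- The local convex envelope of `f`, with values in `ℝ ∪ {+∞}`. -/
def localConvexEnvelope (f : (Fin n → ℤ) → WithTop ℝ) (x : Fin n → ℝ) : WithTop ℝ :=
  sInf (envelopeValues f x)

/-- The infimum that defines the local convex envelope is a genuine greatest lower bound: the set
of values is always bounded below. -/
theorem isGLB_localConvexEnvelope (f : (Fin n → ℤ) → WithTop ℝ) (x : Fin n → ℝ) :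
    IsGLB (envelopeValues f x) (localConvexEnvelope f x) := by
  refine WithTop.isGLB_sInf'
    ⟨∑ z : intNbhd x, ((-|(f z).untopD 0| : ℝ) : WithTop ℝ), ?_⟩
  rintro v ⟨c, hc, -, rfl⟩
  refine Finset.sum_le_sum fun z _ => ?_
  have h0 : 0 ≤ c z := hc.1 z
  have h1 : c z ≤ 1 := by
    rw [← hc.2]
    exact Finset.single_le_sum (fun i _ => hc.1 i) (Finset.mem_univ z)
  cases hf : f z with
  | top =>
    by_cases hz : c z = 0
    · simp [hz]
    · rw [WithTop.mul_top (by exact_mod_cast hz)]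
      exact le_top
  | coe r =>
    rw [← WithTop.coe_mul]
    refine WithTop.coe_le_coe.2 ?_
    simp only [WithTop.untopD_coe]
    nlinarith [neg_abs_le r, abs_nonneg r]

/-- Ordinary convexity of a function `ℝⁿ → ℝ ∪ {+∞}`. -/
def IsConvexExt (g : (Fin n → ℝ) → WithTop ℝ) : Prop :=
  ∀ (x y : Fin n → ℝ) (a : ℝ), 0 ≤ a → a ≤ 1 →
    g (a • x + (1 - a) • y) ≤ (a : WithTop ℝ) * g x + ((1 - a : ℝ) : WithTop ℝ) * g y

/-- Integrally convex functions: the local convex envelope is convex. -/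
def IsIntegrallyConvex (f : (Fin n → ℤ) → WithTop ℝ) : Prop :=
  IsConvexExt (localConvexEnvelope f)

end DiscreteConvexity

end

noncomputable section

namespace DiscreteConvexity

variable {n : ℕ}

/-! Part (1): rounded midpoints depend only on `x + y`. The exchange with `μ = 1` preserves this sum
and brings the pair closer until all coordinates differ by at most one; then `μ = 0` is the midpoint
inequality itself.

Part (2): a finite right-hand side forces finite values at both rounded midpoints.

Part (3): on a box where all distant pairs satisfy the inequality, consider the convex combinations
that represent a point with a bounded mean of `f`, and minimise the second moment. Moving mass from
a distant pair to its rounded midpoints keeps the barycentre, does not raise the mean and lowers the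
second moment (`sum_sq_mid_lt`). So a minimiser is carried by points at mutual distance at most one
(`HasRep.exists_concentrated`), which lie in `N(x)` (`HasRep.of_concentrated`). Hence the envelope
is convex on the box. The local hypothesis gives this for boxes of side 2, thus on short segments.
Applied to the indicator of the domain, the argument works on every box and shows the envelope
finite along any segment with finite ends. A maximum principle then passes from short segments to
long ones. -/

theorem ceilMid_apply (x y : Fin n → ℤ) (i : Fin n) : ceilMid x y i = (x i + y i + 1) / 2 := by
  have h := Int.emod_add_mul_ediv (x i + y i + 1) 2
  have h0 := Int.emod_nonneg (x i + y i + 1) (by norm_num : (2 : ℤ) ≠ 0)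
  have h1 := Int.emod_lt_of_pos (x i + y i + 1) (by norm_num : (0 : ℤ) < 2)
  generalize (x i + y i + 1) / 2 = q at *
  rw [ceilMid, Int.ceil_eq_iff]
  have h2 : 2 * q - 2 < x i + y i := by omega
  have h3 : x i + y i ≤ 2 * q := by omega
  have h2' : 2 * (q : ℝ) - 2 < x i + y i := by exact_mod_cast h2
  have h3' : (x i + y i : ℝ) ≤ 2 * q := by exact_mod_cast h3
  constructor <;> linarith

theorem floorMid_apply (x y : Fin n → ℤ) (i : Fin n) : floorMid x y i = (x i + y i) / 2 := by
  have h := Int.emod_add_mul_ediv (x i + y i) 2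
  have h0 := Int.emod_nonneg (x i + y i) (by norm_num : (2 : ℤ) ≠ 0)
  have h1 := Int.emod_lt_of_pos (x i + y i) (by norm_num : (0 : ℤ) < 2)
  generalize (x i + y i) / 2 = q at *
  rw [floorMid, Int.floor_eq_iff]
  have h2 : 2 * q ≤ x i + y i := by omega
  have h3 : x i + y i < 2 * q + 2 := by omega
  have h2' : 2 * (q : ℝ) ≤ x i + y i := by exact_mod_cast h2
  have h3' : (x i + y i : ℝ) < 2 * q + 2 := by exact_mod_cast h3
  constructor <;> linarith

theorem two_le_norm_sub_iff (x y : Fin n → ℤ) : 2 ≤ ‖x - y‖ ↔ ∃ i, 2 ≤ |x i - y i| := by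
  rw [← not_lt, pi_norm_lt_iff (by norm_num)]
  push Not
  refine exists_congr fun i => ?_
  rw [Int.norm_eq_abs]
  norm_cast

theorem ceilMid_congr {x y x' y' : Fin n → ℤ} (h : ∀ i, x i + y i = x' i + y' i) :
    ceilMid x y = ceilMid x' y' := by
  ext i
  rw [ceilMid_apply, ceilMid_apply, h]

theorem floorMid_congr {x y x' y' : Fin n → ℤ} (h : ∀ i, x i + y i = x' i + y' i) :
    floorMid x y = floorMid x' y' := by
  ext i
  rw [floorMid_apply, floorMid_apply, h]

theorem DiscreteMidpointIneq.symm {f : (Fin n → ℤ) → WithTop ℝ} {x y : Fin n → ℤ}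
    (h : DiscreteMidpointIneq f x y) : DiscreteMidpointIneq f y x := by
  unfold DiscreteMidpointIneq at *
  rwa [ceilMid_congr (x' := x) (y' := y) fun i => add_comm _ _,
    floorMid_congr (x' := x) (y' := y) fun i => add_comm _ _, add_comm (f y)]

/-! ### The implications (1) and (2). -/

/-- An `L♮`-convex function satisfies the discrete midpoint inequality at every pair. -/
theorem IsLNaturalConvex.discreteMidpointIneq {f : (Fin n → ℤ) → WithTop ℝ}
    (hf : IsLNaturalConvex f) (x y : Fin n → ℤ) : DiscreteMidpointIneq f x y := by
  induction hN : ∑ i, (x i - y i).natAbs using Nat.strong_induction_on generalizing x y with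
  | _ N ih =>
    have step : ∀ x y : Fin n → ℤ, ∑ i, (x i - y i).natAbs = N → (∃ i, 2 ≤ x i - y i) →
        DiscreteMidpointIneq f x y := by
      rintro x y hN ⟨j, hj⟩
      have hstep := hf x y 1
      set x' := (x - fun _ => ((1 : ℕ) : ℤ)) ⊔ y with hx'
      set y' := x ⊓ (y + fun _ => ((1 : ℕ) : ℤ)) with hy'
      have ex : ∀ i, x' i = max (x i - 1) (y i) := fun i => by simp [hx']
      have ey : ∀ i, y' i = min (x i) (y i + 1) := fun i => by simp [hy']
      -- A difference `d ≥ 1` becomes `d - 2`, and any other changes sign; the absolute value drops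
      -- exactly when `d ≥ 2`.
      have hlt : ∑ i, (x' i - y' i).natAbs < N := by
        rw [← hN]
        refine Finset.sum_lt_sum (fun i _ => ?_) ⟨j, Finset.mem_univ j, ?_⟩
        · rw [ex, ey]; omega
        · rw [ex, ey]; omega
      have hs : ∀ i, x' i + y' i = x i + y i := fun i => by rw [ex, ey]; omega
      have h := ih _ hlt x' y' rfl
      unfold DiscreteMidpointIneq at *
      rw [ceilMid_congr hs, floorMid_congr hs] at h
      exact h.trans hstep
    by_cases h1 : ∃ i, 2 ≤ x i - y i
    · exact step x y hN h1
    by_cases h2 : ∃ i, 2 ≤ y i - x i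
    · refine (step y x ?_ h2).symm
      rw [← hN]
      exact Finset.sum_congr rfl fun i _ => by omega
    push Not at h1 h2
    -- All differences are now in `{-1, 0, 1}`, where rounding the midpoint up or down gives the
    -- maximum or minimum.
    have h := hf x y 0
    have e1 : (x - fun _ => ((0 : ℕ) : ℤ)) ⊔ y = ceilMid x y := by
      ext i
      have := h1 i
      have := h2 i
      rw [ceilMid_apply]
      simp only [Pi.sup_apply, Pi.sub_apply, Nat.cast_zero]
      omega
    have e2 : x ⊓ (y + fun _ => ((0 : ℕ) : ℤ)) = floorMid x y := by
      ext i
      have := h1 i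
      have := h2 i
      rw [floorMid_apply]
      simp only [Pi.inf_apply, Pi.add_apply, Nat.cast_zero]
      omega
    rwa [e1, e2] at h

theorem IsLNaturalConvex.isGloballyDiscreteMidpointConvex {f : (Fin n → ℤ) → WithTop ℝ}
    (hf : IsLNaturalConvex f) : IsGloballyDiscreteMidpointConvex f :=
  fun x y _ => hf.discreteMidpointIneq x y

theorem IsGloballyDiscreteMidpointConvex.isLocallyDiscreteMidpointConvex
    {f : (Fin n → ℤ) → WithTop ℝ} (hf : IsGloballyDiscreteMidpointConvex f) :
    IsLocallyDiscreteMidpointConvex f := by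
  refine ⟨fun x hx y hy h => ?_, fun x y h => hf x y h.ge⟩
  exact WithTop.add_lt_top.1 ((hf x y h).trans_lt (WithTop.add_lt_top.2 ⟨hx, hy⟩))

/-! ### Concentrating convex combinations. -/

/-- Passing from a distant pair to the rounded midpoints decreases the sum of squares. -/
theorem sum_sq_mid_lt {x y : Fin n → ℤ} (h : 2 ≤ ‖x - y‖) :
    (∑ i, (ceilMid x y i : ℝ) ^ 2) + ∑ i, (floorMid x y i : ℝ) ^ 2 <
      (∑ i, (x i : ℝ) ^ 2) + ∑ i, (y i : ℝ) ^ 2 := by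
  obtain ⟨j, hj⟩ := (two_le_norm_sub_iff x y).1 h
  rw [← Finset.sum_add_distrib, ← Finset.sum_add_distrib]
  have key : ∀ i, (ceilMid x y i + floorMid x y i = x i + y i) ∧
      (ceilMid x y i - floorMid x y i = 0 ∨
        ceilMid x y i - floorMid x y i = 1 ∧ x i ≠ y i) := by
    intro i
    rw [ceilMid_apply, floorMid_apply]
    omega
  -- By the parallelogram identity, for a fixed sum only the differences matter.
  have sq : ∀ c d a b : ℤ, c + d = a + b →
      2 * (a ^ 2 + b ^ 2 - (c ^ 2 + d ^ 2)) = (a - b) ^ 2 - (c - d) ^ 2 := by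
    intro c d a b h
    obtain rfl : c = a + b - d := by omega
    ring
  refine Finset.sum_lt_sum (fun i _ => ?_) ⟨j, Finset.mem_univ j, ?_⟩
  · obtain ⟨h1, h2⟩ := key i
    have h3 := sq _ _ _ _ h1
    have h4 : ceilMid x y i ^ 2 + floorMid x y i ^ 2 ≤ x i ^ 2 + y i ^ 2 := by
      rcases h2 with h2 | ⟨h2, hne⟩
      · rw [h2] at h3
        nlinarith [sq_nonneg (x i - y i)]
      · rw [h2] at h3
        have : 0 < (x i - y i) ^ 2 := by
          have := sub_ne_zero.2 hne
          positivity
        nlinarith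
    exact_mod_cast h4
  · obtain ⟨h1, h2⟩ := key j
    have h3 := sq _ _ _ _ h1
    have h5 : 4 ≤ (x j - y j) ^ 2 := by
      rw [← sq_abs]
      nlinarith
    have h4 : ceilMid x y j ^ 2 + floorMid x y j ^ 2 < x j ^ 2 + y j ^ 2 := by
      rcases h2 with h2 | ⟨h2, -⟩ <;> rw [h2] at h3 <;> linarith
    exact_mod_cast h4

/-- A point `x` is a convex combination of the points of `B` at which `f` has mean at most `r`. -/
def HasRep (f : (Fin n → ℤ) → ℝ) (B : Finset (Fin n → ℤ)) (x : Fin n → ℝ) (r : ℝ) : Prop :=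
  ∃ w : (Fin n → ℤ) → ℝ, (∀ z ∈ B, 0 ≤ w z) ∧ ∑ z ∈ B, w z = 1 ∧
    (∀ i, ∑ z ∈ B, w z * (z i : ℝ) = x i) ∧ ∑ z ∈ B, w z * f z ≤ r

theorem HasRep.mono {f : (Fin n → ℤ) → ℝ} {B C : Finset (Fin n → ℤ)} {x : Fin n → ℝ} {r : ℝ}
    (h : HasRep f B x r) (hBC : B ⊆ C) : HasRep f C x r := by
  classical
  obtain ⟨w, h0, h1, h2, h3⟩ := h
  have key : ∀ g : (Fin n → ℤ) → ℝ,
      ∑ z ∈ C, (if z ∈ B then w z else 0) * g z = ∑ z ∈ B, w z * g z := by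
    intro g
    simp only [ite_mul, zero_mul]
    rw [← Finset.sum_filter, Finset.filter_mem_eq_inter, Finset.inter_eq_right.2 hBC]
  refine ⟨fun z => if z ∈ B then w z else 0, fun z _ => ?_, ?_, fun i => ?_, ?_⟩
  · dsimp only
    split_ifs with hz
    exacts [h0 z hz, le_rfl]
  · have := key 1
    simp only [Pi.one_apply, mul_one] at this
    rw [this, h1]
  · exact (key fun z => (z i : ℝ)).trans (h2 i)
  · exact (key f).trans_le h3

theorem HasRep.convex {f : (Fin n → ℤ) → ℝ} {B : Finset (Fin n → ℤ)} {x y : Fin n → ℝ} {r s a : ℝ}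
    (hx : HasRep f B x r) (hy : HasRep f B y s) (h0 : 0 ≤ a) (h1 : a ≤ 1) :
    HasRep f B (a • x + (1 - a) • y) (a * r + (1 - a) * s) := by
  obtain ⟨w, w0, w1, w2, w3⟩ := hx
  obtain ⟨u, u0, u1, u2, u3⟩ := hy
  have h1' : 0 ≤ 1 - a := by linarith
  have key : ∀ g : (Fin n → ℤ) → ℝ, ∑ z ∈ B, (a * w z + (1 - a) * u z) * g z =
      a * ∑ z ∈ B, w z * g z + (1 - a) * ∑ z ∈ B, u z * g z := by
    intro g
    rw [Finset.mul_sum, Finset.mul_sum, ← Finset.sum_add_distrib]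
    exact Finset.sum_congr rfl fun z _ => by ring
  refine ⟨fun z => a * w z + (1 - a) * u z, fun z hz => ?_, ?_, fun i => ?_, ?_⟩
  · exact add_nonneg (mul_nonneg h0 (w0 z hz)) (mul_nonneg h1' (u0 z hz))
  · have := key 1
    simp only [Pi.one_apply, mul_one] at this
    rw [this, w1, u1]
    ring
  · rw [key fun z => (z i : ℝ), w2, u2]
    simp
  · rw [key f]
    exact add_le_add (mul_le_mul_of_nonneg_left w3 h0) (mul_le_mul_of_nonneg_left u3 h1')

/-- If `B` is closed under rounded midpoints of distant pairs, and these do not increase the sum of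
the values of `f`, then convex combinations may be concentrated on points at mutual distance at
most one. -/
theorem HasRep.exists_concentrated {f : (Fin n → ℤ) → ℝ} {B : Finset (Fin n → ℤ)} {x : Fin n → ℝ}
    {r : ℝ} (h : HasRep f B x r)
    (hB : ∀ p ∈ B, ∀ q ∈ B, 2 ≤ ‖p - q‖ →
      ceilMid p q ∈ B ∧ floorMid p q ∈ B ∧ f (ceilMid p q) + f (floorMid p q) ≤ f p + f q) :
    ∃ w : B → ℝ, (∀ z, 0 ≤ w z) ∧ ∑ z, w z = 1 ∧ (∀ i, ∑ z, w z * (z.1 i : ℝ) = x i) ∧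
      ∑ z, w z * f z ≤ r ∧ ∀ p q, 0 < w p → 0 < w q → ¬ 2 ≤ ‖p.1 - q.1‖ := by
  classical
  obtain ⟨u, u0, u1, u2, u3⟩ := h
  set K : Set (B → ℝ) := stdSimplex ℝ B ∩
    ({w | ∀ i, ∑ z, w z * (z.1 i : ℝ) = x i} ∩ {w | ∑ z, w z * f z ≤ r}) with hK
  have hKc : IsCompact K := by
    refine (isCompact_stdSimplex ℝ B).inter_right (IsClosed.inter ?_ ?_)
    · simp only [Set.ofPred_forall]
      exact isClosed_iInter fun i => isClosed_eq (by fun_prop) (by fun_prop)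
    · exact isClosed_le (by fun_prop) (by fun_prop)
  have hKn : K.Nonempty := by
    refine ⟨fun z => u z, ⟨fun z => u0 z z.2, ?_⟩, fun i => ?_, ?_⟩
    · rw [← u1]; exact Finset.sum_coe_sort B u
    · rw [← u2]; exact Finset.sum_coe_sort B fun z => u z * (z i : ℝ)
    · refine le_trans (le_of_eq ?_) u3
      exact Finset.sum_coe_sort B fun z => u z * f z
  -- The second moment serves as potential: any distant pair in the support of its minimiser would
  -- allow a further decrease.
  obtain ⟨w, hw, hmin⟩ := hKc.exists_isMinOn hKn
    (f := fun w : B → ℝ => ∑ z, w z * ∑ i, (z.1 i : ℝ) ^ 2) (by fun_prop)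
  obtain ⟨⟨w0, w1⟩, w2, w3⟩ := hw
  refine ⟨w, w0, w1, w2, w3, fun p q hp hq hpq => ?_⟩
  obtain ⟨hc, hd, hle⟩ := hB p p.2 q q.2 hpq
  set c : B := ⟨_, hc⟩ with hc'
  set d : B := ⟨_, hd⟩ with hd'
  have hne : p ≠ q := by
    rintro rfl
    simp at hpq
    norm_num at hpq
  -- The largest mass that can leave both `p` and `q` with all weights still nonnegative.
  set ε := min (w p) (w q) with hε
  have hε0 : 0 < ε := lt_min hp hq
  let δ : B → B → ℝ := fun e => Pi.single e 1
  -- Adding point masses also covers `c = d`, which happens when the midpoint is integral.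
  set w' : B → ℝ := fun z => w z + ε * (δ c z + δ d z - δ p z - δ q z) with hw'
  have key : ∀ g : B → ℝ, ∑ z, w' z * g z = ∑ z, w z * g z + ε * (g c + g d - g p - g q) := by
    intro g
    have hs : ∀ e : B, ∑ z, δ e z * g z = g e := by
      intro e
      simp [δ, Pi.single_apply]
    rw [← hs c, ← hs d, ← hs p, ← hs q, ← Finset.sum_add_distrib, ← Finset.sum_sub_distrib,
      ← Finset.sum_sub_distrib, Finset.mul_sum, ← Finset.sum_add_distrib]
    exact Finset.sum_congr rfl fun z _ => by simp only [hw']; ring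
  have hmem : w' ∈ K := by
    refine ⟨⟨fun z => ?_, ?_⟩, fun i => ?_, ?_⟩
    · have s0 : ∀ e : B, 0 ≤ δ e z := fun e => by
        simp only [δ, Pi.single_apply]; split_ifs <;> norm_num
      have hpz : ε * (δ p z + δ q z) ≤ w z := by
        by_cases h1 : z = p
        · subst h1
          simp [δ, hne, hε]
        · by_cases h2 : z = q
          · subst h2
            simp [δ, h1, hε]
          · simp [δ, h1, h2, w0 z]
      have := mul_nonneg hε0.le (add_nonneg (s0 c) (s0 d))
      simp only [hw']
      linarith
    · have := key 1
      simp only [Pi.one_apply, mul_one] at this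
      rw [this, w1]
      ring
    · rw [key fun z => (z.1 i : ℝ), w2]
      have : ceilMid p.1 q.1 i + floorMid p.1 q.1 i = p.1 i + q.1 i := by
        rw [ceilMid_apply, floorMid_apply]
        omega
      have : (ceilMid p.1 q.1 i : ℝ) + floorMid p.1 q.1 i = p.1 i + q.1 i := by
        exact_mod_cast this
      simp only [hc', hd']
      linear_combination ε * this
    · refine (key fun z => f z).trans_le ?_
      simp only [hc', hd']
      have : ε * (f (ceilMid p.1 q.1) + f (floorMid p.1 q.1) - f p - f q) ≤ 0 :=
        mul_nonpos_of_nonneg_of_nonpos hε0.le (by linarith)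
      have w3' : ∑ z, w z * f z ≤ r := w3
      linarith
  have h1 := hmin hmem
  simp only [Set.mem_ofPred_eq] at h1
  rw [key fun z => ∑ i, (z.1 i : ℝ) ^ 2] at h1
  have h2 := sum_sq_mid_lt hpq
  have : ε * ((∑ i, (ceilMid p.1 q.1 i : ℝ) ^ 2) + (∑ i, (floorMid p.1 q.1 i : ℝ) ^ 2)
      - (∑ i, (p.1 i : ℝ) ^ 2) - ∑ i, (q.1 i : ℝ) ^ 2) < 0 :=
    mul_neg_of_pos_of_neg hε0 (by linarith)
  simp only [hc', hd'] at h1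
  linarith

/-- If `z₀` carries weight, then `x - z₀` averages the vectors `z - z₀`, which have entries at most
1 in absolute value and vanish at `z = z₀`. So `|x i - z₀ i| ≤ 1 - w z₀ < 1`. -/
theorem HasRep.of_concentrated {f : (Fin n → ℤ) → ℝ} {B : Finset (Fin n → ℤ)} {x : Fin n → ℝ}
    {r : ℝ} {w : B → ℝ} (w0 : ∀ z, 0 ≤ w z) (w1 : ∑ z, w z = 1)
    (w2 : ∀ i, ∑ z, w z * (z.1 i : ℝ) = x i) (w3 : ∑ z, w z * f z ≤ r)
    (w4 : ∀ p q, 0 < w p → 0 < w q → ¬ 2 ≤ ‖p.1 - q.1‖) :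
    HasRep f ((intNbhd_finite x).toFinset ∩ B) x r := by
  classical
  have hN : ∀ z₀ : B, 0 < w z₀ → z₀.1 ∈ intNbhd x := by
    intro z₀ hz₀ i
    have e : x i - z₀.1 i = ∑ z, w z * ((z.1 i : ℝ) - z₀.1 i) := by
      simp only [mul_sub, Finset.sum_sub_distrib]
      rw [w2, ← Finset.sum_mul, w1, one_mul]
    rw [e]
    have hterm : ∀ z, |w z * ((z.1 i : ℝ) - z₀.1 i)| ≤ w z - if z = z₀ then w z₀ else 0 := by
      intro z
      split_ifs with h
      · subst h
        simp
      · rcases (w0 z).eq_or_lt with h0 | h0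
        · simp [← h0]
        · have h2 := w4 z z₀ h0 hz₀
          rw [two_le_norm_sub_iff] at h2
          push Not at h2
          have h3 : |z.1 i - z₀.1 i| ≤ 1 := by have := h2 i; omega
          have h3' : |(z.1 i : ℝ) - z₀.1 i| ≤ 1 := by exact_mod_cast h3
          rw [abs_mul, abs_of_pos h0]
          nlinarith
    calc |∑ z, w z * ((z.1 i : ℝ) - z₀.1 i)|
        ≤ ∑ z, |w z * ((z.1 i : ℝ) - z₀.1 i)| := Finset.abs_sum_le_sum_abs _ _
      _ ≤ ∑ z, (w z - if z = z₀ then w z₀ else 0) := Finset.sum_le_sum fun z _ => hterm z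
      _ = 1 - w z₀ := by
        rw [Finset.sum_sub_distrib, w1]
        simp
      _ < 1 := by linarith
  let u : (Fin n → ℤ) → ℝ := fun z => if h : z ∈ B then w ⟨z, h⟩ else 0
  have hu : ∀ z : B, u z = w z := fun z => by simp [u]
  have hu0 : ∀ z, 0 ≤ u z := by
    intro z
    by_cases h : z ∈ B
    · simp [u, h, w0]
    · simp [u, h]
  have key : ∀ g : (Fin n → ℤ) → ℝ,
      ∑ z ∈ (intNbhd_finite x).toFinset ∩ B, u z * g z = ∑ z : B, w z * g z := by
    intro g
    rw [Finset.sum_subset Finset.inter_subset_right, ← Finset.sum_coe_sort]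
    · exact Finset.sum_congr rfl fun z _ => by rw [hu]
    · intro z hz hz'
      have : ¬ 0 < u z := fun h => hz' <| by
        rw [hu ⟨z, hz⟩] at h
        exact Finset.mem_inter.2 ⟨(Set.Finite.mem_toFinset _).2 (hN _ h), hz⟩
      rw [le_antisymm (not_lt.1 this) (hu0 z), zero_mul]
  refine ⟨u, fun z _ => hu0 z, ?_, fun i => ?_, ?_⟩
  · have := key 1
    simpa only [Pi.one_apply, mul_one, w1] using this
  · rw [key fun z => (z i : ℝ), w2]
  · rwa [key]

/-! ### The envelope in terms of real-valued representations. -/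

/-- The points of `N(x)` in the effective domain. -/
def domNbhd (f : (Fin n → ℤ) → WithTop ℝ) (x : Fin n → ℝ) : Finset (Fin n → ℤ) :=
  ((intNbhd_finite x).subset (Set.inter_subset_left (t := effDom f))).toFinset

theorem mem_domNbhd {f : (Fin n → ℤ) → WithTop ℝ} {x : Fin n → ℝ} {z : Fin n → ℤ} :
    z ∈ domNbhd f x ↔ z ∈ intNbhd x ∧ f z < ⊤ := by
  simp [domNbhd, effDom]

theorem sum_intNbhd (x : Fin n → ℝ) {M : Type*} [AddCommMonoid M] (g : (Fin n → ℤ) → M) :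
    ∑ z : intNbhd x, g z = ∑ z ∈ (intNbhd_finite x).toFinset, g z :=
  Finset.sum_subtype _ (fun _ => Set.Finite.mem_toFinset _) g |>.symm

theorem localConvexEnvelope_le {f : (Fin n → ℤ) → WithTop ℝ} {x : Fin n → ℝ} {r : ℝ}
    (h : HasRep (fun z => (f z).untopD 0) (domNbhd f x) x r) : localConvexEnvelope f x ≤ r := by
  classical
  obtain ⟨w, w0, w1, w2, w3⟩ := h
  let u : (Fin n → ℤ) → ℝ := fun z => if z ∈ domNbhd f x then w z else 0
  have hu : ∀ z ∈ domNbhd f x, u z = w z := fun z hz => by simp [u, hz]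
  have hsub : domNbhd f x ⊆ (intNbhd_finite x).toFinset := fun z hz =>
    (Set.Finite.mem_toFinset _).2 (mem_domNbhd.1 hz).1
  have key : ∀ g : (Fin n → ℤ) → ℝ,
      ∑ z : intNbhd x, u z * g z = ∑ z ∈ domNbhd f x, w z * g z := by
    intro g
    rw [sum_intNbhd x fun z => u z * g z, ← Finset.sum_subset hsub]
    · exact Finset.sum_congr rfl fun z hz => by rw [hu z hz]
    · intro z _ hz
      simp [u, hz]
  refine ((isGLB_localConvexEnvelope f x).1 ⟨fun z => u z, ⟨fun z => ?_, ?_⟩, fun i => ?_, rfl⟩).trans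
    (?_ : _ ≤ (r : WithTop ℝ))
  · dsimp only [u]
    split_ifs with hz
    exacts [w0 z hz, le_rfl]
  · have := key 1
    simpa only [Pi.one_apply, mul_one, w1] using this
  · rw [key fun z => (z i : ℝ), w2]
  · have : ∑ z : intNbhd x, ((u z : ℝ) : WithTop ℝ) * f z =
        ((∑ z : intNbhd x, u z * (f z).untopD 0 : ℝ) : WithTop ℝ) := by
      rw [WithTop.coe_sum]
      refine Finset.sum_congr rfl fun z _ => ?_
      by_cases hz : f z < ⊤
      · lift f z to ℝ using hz.ne with s
        simp
      · have : u z = 0 := by simp [u, mem_domNbhd, hz]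
        simp [this]
    rw [this, key fun z => (f z).untopD 0]
    exact WithTop.coe_le_coe.2 w3

/-- Strictness yields an actual combination without attainment of the infimum. Its weights vanish
off the domain, since otherwise its value would be `⊤`; so the default in `untopD 0` plays no role.
-/
theorem hasRep_of_localConvexEnvelope_lt {f : (Fin n → ℤ) → WithTop ℝ} {x : Fin n → ℝ} {r : ℝ}
    (h : localConvexEnvelope f x < r) :
    HasRep (fun z => (f z).untopD 0) (domNbhd f x) x r := by
  classical
  obtain ⟨v, ⟨c, ⟨c0, c1⟩, c2, rfl⟩, -, hv⟩ := (isGLB_localConvexEnvelope f x).exists_between h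
  have hc : ∀ z : intNbhd x, ¬ f z < ⊤ → c z = 0 := by
    intro z hz
    by_contra hne
    have h1 : ((c z : ℝ) : WithTop ℝ) * f z = ⊤ := by
      rw [not_lt_top_iff.1 hz, WithTop.mul_top (by exact_mod_cast hne)]
    have h2 := WithTop.sum_lt_top.1 (hv.trans (WithTop.coe_lt_top r)) z (Finset.mem_univ z)
    exact h2.ne h1
  let u : (Fin n → ℤ) → ℝ := fun z => if h : z ∈ intNbhd x then c ⟨z, h⟩ else 0
  have hu : ∀ z : intNbhd x, u z = c z := fun z => by simp [u]
  have hsub : domNbhd f x ⊆ (intNbhd_finite x).toFinset := fun z hz =>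
    (Set.Finite.mem_toFinset _).2 (mem_domNbhd.1 hz).1
  have key : ∀ g : (Fin n → ℤ) → ℝ,
      ∑ z ∈ domNbhd f x, u z * g z = ∑ z : intNbhd x, c z * g z := by
    intro g
    rw [Finset.sum_subset hsub, ← sum_intNbhd x fun z => u z * g z]
    · exact Finset.sum_congr rfl fun z _ => by rw [hu]
    · intro z hz hz'
      have hz : z ∈ intNbhd x := (Set.Finite.mem_toFinset _).1 hz
      have := hc ⟨z, hz⟩ fun h => hz' (mem_domNbhd.2 ⟨hz, h⟩)
      rw [hu ⟨z, hz⟩, this, zero_mul]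
  refine ⟨u, fun z hz => ?_, ?_, fun i => ?_, ?_⟩
  · rw [hu ⟨z, (mem_domNbhd.1 hz).1⟩]
    exact c0 _
  · have := key 1
    simpa only [Pi.one_apply, mul_one, c1] using this
  · rw [key fun z => (z i : ℝ), c2]
  · rw [key]
    have e : ∑ z : intNbhd x, ((c z : ℝ) : WithTop ℝ) * f z =
        ((∑ z : intNbhd x, c z * (f z).untopD 0 : ℝ) : WithTop ℝ) := by
      rw [WithTop.coe_sum]
      refine Finset.sum_congr rfl fun z _ => ?_
      by_cases hz : f z < ⊤
      · lift f z to ℝ using hz.ne with s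
        simp
      · simp [hc z hz]
    rw [e] at hv
    exact (WithTop.coe_lt_coe.1 hv).le

/-! ### Convexity on boxes and finiteness on segments. -/

/-- If the discrete midpoint inequality holds for all distant pairs of a box, then the local convex
envelope is convex on this box. -/
theorem localConvexEnvelope_convex_of_box {f : (Fin n → ℤ) → WithTop ℝ} {a b : Fin n → ℤ}
    (hf : ∀ p ∈ Set.Icc a b, ∀ q ∈ Set.Icc a b, 2 ≤ ‖p - q‖ → DiscreteMidpointIneq f p q)
    {x y : Fin n → ℝ} (hx : ∀ i, (a i : ℝ) ≤ x i ∧ x i ≤ b i)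
    (hy : ∀ i, (a i : ℝ) ≤ y i ∧ y i ≤ b i) {t r s : ℝ} (h0 : 0 ≤ t) (h1 : t ≤ 1)
    (hr : localConvexEnvelope f x ≤ r) (hs : localConvexEnvelope f y ≤ s) :
    localConvexEnvelope f (t • x + (1 - t) • y) ≤ ((t * r + (1 - t) * s : ℝ) : WithTop ℝ) := by
  classical
  set B : Finset (Fin n → ℤ) := (Finset.Icc a b).filter fun z => f z < ⊤ with hBdef
  have hsub : ∀ x : Fin n → ℝ, (∀ i, (a i : ℝ) ≤ x i ∧ x i ≤ b i) → domNbhd f x ⊆ B := by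
    intro x hx z hz
    rw [mem_domNbhd] at hz
    refine Finset.mem_filter.2 ⟨Finset.mem_Icc.2 ⟨fun i => ?_, fun i => ?_⟩, hz.2⟩
    · have h := abs_lt.1 (hz.1 i)
      have : (a i : ℝ) < ((z i + 1 : ℤ) : ℝ) := by push_cast; linarith [(hx i).1]
      have : a i < z i + 1 := by exact_mod_cast this
      exact Int.lt_add_one_iff.1 this
    · have h := abs_lt.1 (hz.1 i)
      have : (z i : ℝ) < ((b i + 1 : ℤ) : ℝ) := by push_cast; linarith [(hx i).2]
      have : z i < b i + 1 := by exact_mod_cast this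
      exact Int.lt_add_one_iff.1 this
  have hB : ∀ p ∈ B, ∀ q ∈ B, 2 ≤ ‖p - q‖ → ceilMid p q ∈ B ∧ floorMid p q ∈ B ∧
      (f (ceilMid p q)).untopD 0 + (f (floorMid p q)).untopD 0 ≤
        (f p).untopD 0 + (f q).untopD 0 := by
    intro p hp q hq hpq
    obtain ⟨hp, hpt⟩ := Finset.mem_filter.1 hp
    obtain ⟨hq, hqt⟩ := Finset.mem_filter.1 hq
    rw [Finset.mem_Icc] at hp hq
    have hle : f (ceilMid p q) + f (floorMid p q) ≤ f p + f q := hf p hp q hq hpq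
    obtain ⟨hc, hd⟩ := WithTop.add_lt_top.1 (hle.trans_lt (WithTop.add_lt_top.2 ⟨hpt, hqt⟩))
    refine ⟨Finset.mem_filter.2 ⟨Finset.mem_Icc.2 ⟨fun i => ?_, fun i => ?_⟩, hc⟩,
      Finset.mem_filter.2 ⟨Finset.mem_Icc.2 ⟨fun i => ?_, fun i => ?_⟩, hd⟩, ?_⟩
    · have h1 : a i ≤ p i := hp.1 i
      have h2 : a i ≤ q i := hq.1 i
      have h3 : a i ≤ ceilMid p q i := by rw [ceilMid_apply]; omega
      exact h3
    · have h1 : p i ≤ b i := hp.2 i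
      have h2 : q i ≤ b i := hq.2 i
      have h3 : ceilMid p q i ≤ b i := by rw [ceilMid_apply]; omega
      exact h3
    · have h1 : a i ≤ p i := hp.1 i
      have h2 : a i ≤ q i := hq.1 i
      have h3 : a i ≤ floorMid p q i := by rw [floorMid_apply]; omega
      exact h3
    · have h1 : p i ≤ b i := hp.2 i
      have h2 : q i ≤ b i := hq.2 i
      have h3 : floorMid p q i ≤ b i := by rw [floorMid_apply]; omega
      exact h3
    · lift f (ceilMid p q) to ℝ using hc.ne with c
      lift f (floorMid p q) to ℝ using hd.ne with d
      lift f p to ℝ using hpt.ne with p'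
      lift f q to ℝ using hqt.ne with q'
      exact_mod_cast hle
  have hsub' : ∀ x : Fin n → ℝ, (intNbhd_finite x).toFinset ∩ B ⊆ domNbhd f x := by
    intro x z hz
    rw [Finset.mem_inter, Set.Finite.mem_toFinset, hBdef, Finset.mem_filter] at hz
    exact mem_domNbhd.2 ⟨hz.1, hz.2.2⟩
  -- The slack `ε` supplies the strict inequality needed to extract representations.
  have main : ∀ ε : ℝ, 0 < ε → localConvexEnvelope f (t • x + (1 - t) • y) ≤
      ((t * r + (1 - t) * s + ε : ℝ) : WithTop ℝ) := by
    intro ε hε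
    have hx' := (hasRep_of_localConvexEnvelope_lt (r := r + ε)
      (hr.trans_lt (WithTop.coe_lt_coe.2 (by linarith)))).mono (hsub x hx)
    have hy' := (hasRep_of_localConvexEnvelope_lt (r := s + ε)
      (hs.trans_lt (WithTop.coe_lt_coe.2 (by linarith)))).mono (hsub y hy)
    obtain ⟨w, w0, w1, w2, w3, w4⟩ := (hx'.convex hy' h0 h1).exists_concentrated hB
    have := localConvexEnvelope_le ((HasRep.of_concentrated w0 w1 w2 w3 w4).mono (hsub' _))
    rwa [show t * (r + ε) + (1 - t) * (s + ε) = t * r + (1 - t) * s + ε by ring] at this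
  have hfin := (main 1 one_pos).trans_lt (WithTop.coe_lt_top _)
  lift localConvexEnvelope f (t • x + (1 - t) • y) to ℝ using hfin.ne with v
  refine WithTop.coe_le_coe.2 (le_of_forall_pos_le_add fun ε hε => ?_)
  exact WithTop.coe_le_coe.1 (main ε hε)

/-- The indicator function of the effective domain. -/
def domIndicator (f : (Fin n → ℤ) → WithTop ℝ) (x : Fin n → ℤ) : WithTop ℝ :=
  open Classical in if f x < ⊤ then 0 else ⊤

theorem domIndicator_lt_top {f : (Fin n → ℤ) → WithTop ℝ} {x : Fin n → ℤ} :
    domIndicator f x < ⊤ ↔ f x < ⊤ := by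
  unfold domIndicator
  split_ifs with h <;> simp [h]

/-- The weights that witness finiteness for `f` also do so for `g`. -/
theorem localConvexEnvelope_lt_top_of_imp {f g : (Fin n → ℤ) → WithTop ℝ} (h : ∀ z, f z < ⊤ → g z < ⊤)
    {x : Fin n → ℝ} (hx : localConvexEnvelope f x < ⊤) : localConvexEnvelope g x < ⊤ := by
  obtain ⟨r, hr⟩ := WithTop.ne_top_iff_exists.1 hx.ne
  obtain ⟨w, w0, w1, w2, -⟩ := hasRep_of_localConvexEnvelope_lt (f := f) (x := x) (r := r + 1)
    (by rw [← hr]; exact WithTop.coe_lt_coe.2 (by linarith))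
  have h' : HasRep (fun z => (g z).untopD 0) (domNbhd f x) x _ := ⟨w, w0, w1, w2, le_rfl⟩
  refine (localConvexEnvelope_le (h'.mono fun z hz => ?_)).trans_lt (WithTop.coe_lt_top _)
  rw [mem_domNbhd] at hz ⊢
  exact ⟨hz.1, h z hz.2⟩

theorem localConvexEnvelope_domIndicator_lt_top {f : (Fin n → ℤ) → WithTop ℝ} {x : Fin n → ℝ} :
    localConvexEnvelope (domIndicator f) x < ⊤ ↔ localConvexEnvelope f x < ⊤ :=
  ⟨localConvexEnvelope_lt_top_of_imp fun _ => domIndicator_lt_top.1,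
    localConvexEnvelope_lt_top_of_imp fun _ => domIndicator_lt_top.2⟩

/-- For values in `{0, ⊤}` the inequality is just closure of the domain under rounded midpoints,
which is assumed at every distance `≥ 2`. Boxes of any size thus become available. -/
theorem IsDiscreteMidpointConvexSet.isGloballyDiscreteMidpointConvex_domIndicator
    {f : (Fin n → ℤ) → WithTop ℝ} (hf : IsDiscreteMidpointConvexSet (effDom f)) :
    IsGloballyDiscreteMidpointConvex (domIndicator f) := by
  intro x y hxy
  unfold DiscreteMidpointIneq
  by_cases hx : f x < ⊤
  · by_cases hy : f y < ⊤
    · obtain ⟨hc, hd⟩ := hf x hx y hy hxy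
      simp only [effDom, Set.mem_ofPred_eq] at hc hd
      simp [domIndicator, hx, hy, hc, hd]
    · simp [domIndicator, hy]
  · simp [domIndicator, hx]

/-- The effective domain of the local convex envelope is convex if that of `f` is discrete midpoint
convex. -/
theorem IsDiscreteMidpointConvexSet.localConvexEnvelope_lt_top {f : (Fin n → ℤ) → WithTop ℝ}
    (hf : IsDiscreteMidpointConvexSet (effDom f)) {x y : Fin n → ℝ}
    (hx : localConvexEnvelope f x < ⊤) (hy : localConvexEnvelope f y < ⊤) {t : ℝ} (h0 : 0 ≤ t)
    (h1 : t ≤ 1) : localConvexEnvelope f (t • x + (1 - t) • y) < ⊤ := by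
  rw [← localConvexEnvelope_domIndicator_lt_top] at hx hy ⊢
  obtain ⟨r, hr⟩ := WithTop.ne_top_iff_exists.1 hx.ne
  obtain ⟨s, hs⟩ := WithTop.ne_top_iff_exists.1 hy.ne
  refine (localConvexEnvelope_convex_of_box (a := fun i => min ⌊x i⌋ ⌊y i⌋)
    (b := fun i => max ⌈x i⌉ ⌈y i⌉) (fun p _ q _ h =>
      hf.isGloballyDiscreteMidpointConvex_domIndicator p q h) (fun i => ?_) (fun i => ?_) h0 h1
      hr.ge hs.ge).trans_lt (WithTop.coe_lt_top _)
  · push_cast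
    exact ⟨(min_le_left _ _).trans (Int.floor_le _), (Int.le_ceil _).trans (le_max_left _ _)⟩
  · push_cast
    exact ⟨(min_le_right _ _).trans (Int.floor_le _), (Int.le_ceil _).trans (le_max_right _ _)⟩

/-! ### From short segments to convexity. -/

/-- The local convex envelope of a locally discrete midpoint convex function is convex on each box
of radius `1 / 2`. -/
theorem IsLocallyDiscreteMidpointConvex.localConvexEnvelope_convex_near
    {f : (Fin n → ℤ) → WithTop ℝ} (hf : IsLocallyDiscreteMidpointConvex f) {c x y : Fin n → ℝ}
    (hx : ∀ i, |x i - c i| ≤ 1 / 2) (hy : ∀ i, |y i - c i| ≤ 1 / 2) {t r s : ℝ} (h0 : 0 ≤ t)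
    (h1 : t ≤ 1) (hr : localConvexEnvelope f x ≤ r) (hs : localConvexEnvelope f y ≤ s) :
    localConvexEnvelope f (t • x + (1 - t) • y) ≤ ((t * r + (1 - t) * s : ℝ) : WithTop ℝ) := by
  have hbox : ∀ x : Fin n → ℝ, (∀ i, |x i - c i| ≤ 1 / 2) →
      ∀ i, ((round (c i) - 1 : ℤ) : ℝ) ≤ x i ∧ x i ≤ ((round (c i) + 1 : ℤ) : ℝ) := by
    intro x hx i
    have h1 := abs_le.1 (hx i)
    have h2 := abs_le.1 (abs_sub_round (c i))
    push_cast
    constructor <;> linarith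
  -- Rounding `c` costs another `1 / 2`, hence radius 1. Points of this box are at distance at most
  -- 2, so "at least 2" means "equal to 2".
  refine localConvexEnvelope_convex_of_box (a := fun i => round (c i) - 1)
    (b := fun i => round (c i) + 1) (fun p hp q hq h => hf.2 p q (le_antisymm ?_ h))
    (hbox x hx) (hbox y hy) h0 h1 hr hs
  refine (pi_norm_le_iff_of_nonneg (by norm_num)).2 fun i => ?_
  have a1 : round (c i) - 1 ≤ p i := hp.1 i
  have a2 : p i ≤ round (c i) + 1 := hp.2 i
  have a3 : round (c i) - 1 ≤ q i := hq.1 i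
  have a4 : q i ≤ round (c i) + 1 := hq.2 i
  rw [Int.norm_eq_abs, Pi.sub_apply]
  have : |p i - q i| ≤ 2 := by rw [abs_le]; omega
  exact_mod_cast this

/-- A discrete maximum principle. -/
theorem nonpos_of_le_convex_comb_neighbors {g : ℕ → ℝ} {N : ℕ} (h0 : g 0 ≤ 0) (hN : g N ≤ 0)
    (h : ∀ k, k + 1 < N → ∃ α : ℝ, 0 < α ∧ α < 1 ∧ g (k + 1) ≤ α * g k + (1 - α) * g (k + 2))
    {m : ℕ} (hm : m ≤ N) : g m ≤ 0 := by
  classical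
  by_contra! hpos
  have hex : ∃ k, k ≤ N ∧ ∀ j ≤ N, g j ≤ g k := by
    obtain ⟨k, hk, hmax⟩ := (Finset.range (N + 1)).exists_max_image g ⟨0, by simp⟩
    exact ⟨k, by simpa [Nat.lt_succ_iff] using hk, fun j hj => hmax j (by simpa [Nat.lt_succ_iff] using hj)⟩
  -- The first maximiser has a strictly smaller left neighbour, which contradicts the averaging
  -- bound because `α > 0`.
  obtain ⟨hkN, hmax⟩ := Nat.find_spec hex
  have hmin := fun j => Nat.find_min hex (m := j)
  generalize Nat.find hex = k at *
  have hk := hpos.trans_le (hmax m hm)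
  cases k with
  | zero => linarith
  | succ k =>
    have hne : k + 1 ≠ N := by
      rintro rfl
      linarith
    obtain ⟨α, α0, α1, hα⟩ := h k (by omega)
    have h1 : g k < g (k + 1) := by
      by_contra! hle
      exact hmin k (by omega) ⟨by omega, fun j hj => (hmax j hj).trans hle⟩
    have h2 := hmax (k + 2) (by omega)
    nlinarith

/-- A function on `[0, 1]` which is convex on all short segments is convex. -/
theorem le_segment_of_locally_convex {φ : ℝ → ℝ} {δ : ℝ} (hδ : 0 < δ)
    (h : ∀ s u α : ℝ, s ∈ Set.Icc 0 1 → u ∈ Set.Icc 0 1 → |s - u| ≤ δ → 0 ≤ α → α ≤ 1 →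
      φ (α * s + (1 - α) * u) ≤ α * φ s + (1 - α) * φ u)
    {t : ℝ} (ht0 : 0 < t) (ht1 : t < 1) : φ t ≤ t * φ 1 + (1 - t) * φ 0 := by
  obtain ⟨N, hN⟩ := exists_nat_gt (2 / δ)
  have hN0 : (0 : ℝ) < N := (by positivity : 0 < 2 / δ).trans hN
  have hNδ : 2 / (N : ℝ) ≤ δ := by
    rw [div_lt_iff₀ hδ] at hN
    rw [div_le_iff₀ hN0]
    linarith
  -- `N` equal steps on `[0, t]` followed by `N` on `[t, 1]`: the grid hits `t` exactly at index
  -- `N`. Points two indices apart are within `2 / N ≤ δ`.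
  set τ : ℕ → ℝ := fun k => (t * (min k N : ℕ) + (1 - t) * (k - N : ℕ)) / N with hτ
  have hτ0 : τ 0 = 0 := by simp [hτ]
  have hτN : τ N = t := by simp [hτ, hN0.ne']
  have hτ1 : τ (2 * N) = 1 := by
    have e1 : min (2 * N) N = N := by omega
    have e2 : 2 * N - N = N := by omega
    simp only [hτ, e1, e2]
    field_simp
    ring
  have hinc : ∀ k, τ k < τ (k + 1) ∧ τ (k + 1) - τ k ≤ 1 / N := by
    intro k
    have hd : τ (k + 1) - τ k = t / N ∨ τ (k + 1) - τ k = (1 - t) / N := by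
      by_cases hk : k < N
      · left
        have e1 : min (k + 1) N = k + 1 := by omega
        have e2 : min k N = k := by omega
        have e3 : k + 1 - N = 0 := by omega
        have e4 : k - N = 0 := by omega
        simp only [hτ, e1, e2, e3, e4]
        push_cast
        ring
      · right
        have e1 : min (k + 1) N = N := by omega
        have e2 : min k N = N := by omega
        have e3 : k + 1 - N = (k - N) + 1 := by omega
        simp only [hτ, e1, e2, e3]
        push_cast
        ring
    have hpos : 0 < t / N ∧ t / N ≤ 1 / N := ⟨by positivity, by gcongr⟩
    have hpos' : 0 < (1 - t) / N ∧ (1 - t) / N ≤ 1 / N :=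
      ⟨div_pos (by linarith) hN0, by gcongr; linarith⟩
    rcases hd with hd | hd <;> rw [hd] <;> constructor <;> linarith
  have hmono : StrictMono τ := strictMono_nat_of_lt_succ fun k => (hinc k).1
  have hmem : ∀ k ≤ 2 * N, τ k ∈ Set.Icc (0 : ℝ) 1 := fun k hk =>
    ⟨hτ0 ▸ hmono.monotone (Nat.zero_le k), hτ1 ▸ hmono.monotone hk⟩
  -- Subtracting the chord gives zero end values and keeps convexity on short segments.
  set ψ : ℝ → ℝ := fun s => φ s - (s * φ 1 + (1 - s) * φ 0) with hψ
  have hmax := nonpos_of_le_convex_comb_neighbors (g := fun k => ψ (τ k)) (N := 2 * N) (m := N)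
    (by simp [hψ, hτ0]) (by simp only [hτ1, hψ]; linarith) (fun k hk => ?_) (by omega)
  · simp only [hτN, hψ] at hmax
    linarith
  · obtain ⟨a1, a2⟩ := hinc k
    obtain ⟨b1, b2⟩ := hinc (k + 1)
    have hd : 0 < τ (k + 1 + 1) - τ k := by linarith
    set α := (τ (k + 1 + 1) - τ (k + 1)) / (τ (k + 1 + 1) - τ k) with hα
    have hα0 : 0 < α := div_pos (by linarith) hd
    have hα1 : α < 1 := (div_lt_one hd).2 (by linarith)
    have hτα : α * τ k + (1 - α) * τ (k + 2) = τ (k + 1) := by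
      have : α * (τ (k + 2) - τ k) = τ (k + 2) - τ (k + 1) := div_mul_cancel₀ _ hd.ne'
      linarith
    refine ⟨α, hα0, hα1, ?_⟩
    have hdist : |τ k - τ (k + 2)| ≤ δ := by
      rw [abs_sub_comm, abs_of_pos hd]
      have : (2 : ℝ) / N = 1 / N + 1 / N := by ring
      have e : τ (k + 2) = τ (k + 1 + 1) := rfl
      linarith
    have := h (τ k) (τ (k + 2)) α (hmem _ (by omega)) (hmem _ (by omega)) hdist hα0.le hα1.le
    rw [hτα] at this
    simp only [hψ]
    linear_combination this + (φ 1 - φ 0) * hτα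

/-- Locally discrete midpoint convex functions are integrally convex. -/
theorem IsLocallyDiscreteMidpointConvex.isIntegrallyConvex {f : (Fin n → ℤ) → WithTop ℝ}
    (hf : IsLocallyDiscreteMidpointConvex f) : IsIntegrallyConvex f := by
  intro x y t ht0 ht1
  -- The end cases are separate because `0 * ⊤ = 0`; for `0 < t < 1` an infinite end value makes the
  -- right side `⊤`.
  rcases ht0.eq_or_lt with rfl | ht0'
  · simp
  rcases ht1.eq_or_lt with rfl | ht1'
  · simp
  by_cases hx : localConvexEnvelope f x < ⊤
  swap
  · rw [not_lt_top_iff.1 hx, WithTop.mul_top (by exact_mod_cast ht0'.ne'), top_add]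
    exact le_top
  by_cases hy : localConvexEnvelope f y < ⊤
  swap
  · have : (1 - t) ≠ 0 := by linarith
    rw [not_lt_top_iff.1 hy, WithTop.mul_top (by exact_mod_cast this), add_top]
    exact le_top
  set P : ℝ → Fin n → ℝ := fun s => s • x + (1 - s) • y with hP
  set φ : ℝ → ℝ := fun s => (localConvexEnvelope f (P s)).untopD 0 with hφ
  have hcoe : ∀ s ∈ Set.Icc (0 : ℝ) 1, localConvexEnvelope f (P s) = (φ s : WithTop ℝ) := by
    intro s hs
    have := hf.1.localConvexEnvelope_lt_top hx hy hs.1 hs.2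
    rw [hφ]
    simp only [hP] at this ⊢
    lift localConvexEnvelope f (s • x + (1 - s) • y) to ℝ using this.ne with v
    rfl
  have hP1 : P 1 = x := by simp [hP]
  have hP0 : P 0 = y := by simp [hP]
  -- With this `δ`, parameters within `δ` give points within `1 / 2`; the `+ 1` covers `x = y`.
  have hδ : 0 < 1 / (2 * (‖x - y‖ + 1)) := by positivity
  have key := le_segment_of_locally_convex (φ := φ) hδ (fun s u α hs hu hsu h0 h1 => ?_) ht0' ht1'
  · have e1 := hcoe 1 (by simp)
    have e0 := hcoe 0 (by simp)
    rw [hP1] at e1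
    rw [hP0] at e0
    rw [e1, e0, ← WithTop.coe_mul, ← WithTop.coe_mul, ← WithTop.coe_add]
    exact (hcoe t ⟨ht0, ht1⟩).trans_le (WithTop.coe_le_coe.2 key)
  · have hPα : α • P s + (1 - α) • P u = P (α * s + (1 - α) * u) := by
      ext i
      simp only [hP, Pi.add_apply, Pi.smul_apply, smul_eq_mul]
      ring
    have hmem : α * s + (1 - α) * u ∈ Set.Icc (0 : ℝ) 1 :=
      convex_Icc (0 : ℝ) 1 hs hu h0 (by linarith) (by ring)
    have hnear : ∀ i, |P s i - P u i| ≤ 1 / 2 := by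
      intro i
      have e : P s i - P u i = (s - u) * (x - y) i := by
        simp only [hP, Pi.add_apply, Pi.smul_apply, Pi.sub_apply, smul_eq_mul]
        ring
      have hi : |(x - y) i| ≤ ‖x - y‖ := norm_le_pi_norm (x - y) i
      rw [e, abs_mul]
      calc |s - u| * |(x - y) i| ≤ 1 / (2 * (‖x - y‖ + 1)) * (‖x - y‖ + 1) := by
            gcongr
            linarith
        _ = 1 / 2 := by
            have : ‖x - y‖ + 1 ≠ 0 := by positivity
            field_simp
    have := hf.localConvexEnvelope_convex_near (c := P u) hnear (fun i => by simp) h0 h1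
      (hcoe s hs).le (hcoe u hu).le
    rw [hPα, hcoe _ hmem] at this
    exact WithTop.coe_le_coe.1 this

end DiscreteConvexity

end

theorem theorem2p3 (n : ℕ) (f : (Fin n → ℤ) → WithTop ℝ) :
    (DiscreteConvexity.IsLNaturalConvex f →
      DiscreteConvexity.IsGloballyDiscreteMidpointConvex f) ∧
    (DiscreteConvexity.IsGloballyDiscreteMidpointConvex f →
      DiscreteConvexity.IsLocallyDiscreteMidpointConvex f) ∧
    (DiscreteConvexity.IsLocallyDiscreteMidpointConvex f →
      DiscreteConvexity.IsIntegrallyConvex f) :=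
  ⟨fun h => h.isGloballyDiscreteMidpointConvex, fun h => h.isLocallyDiscreteMidpointConvex,
    fun h => h.isIntegrallyConvex⟩
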